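/- Let $r=(r_1,\dots,r_m):\mathbb R^n\to\mathbb R^m$ be continuously differentiable with Lipschitz continuous Jacobian $J$, let $\kappa_i>0$ satisfy $\|\nabla r_i(x)-\nabla r_i(y)\|\le\kappa_i\|x-y\|$ for all $x,y\in\mathbb R^n$, and put $\kappa_{\max}=\max_i\kappa_i$, $f(x)=\tfrac12\|r(x)\|^2$. All vector norms are Euclidean. Let $x_0\in\mathbb R^n$ with $r_0:=r(x_0)\ne0$, let $d_{-1}\in\mathbb R^n\setminus\{0\}$ be arbitrary (it only fixes the first smoothing radius), and let $1\le b\le n$. **Algorithm.** Let $a_1>1>a_2>0$, $a_1a_2<1$, $0<p_0<1$, $p_0<p_1<p_2$, $\theta_0\ge\theta_{\min}>0$, $\varepsilon_0\ge0$. In iteration $k=0,1,2,\dots$ draw $[u_1,\dots,u_b]$ from the uniform (i.e. $O(n)$-invariant) probability distribution on the Stiefel manifold $\{U\in\mathbb R^{n\times b}:U^TU=I_b\}$, independently of the earlier iterations, put $\gamma_k=\|d_{k-1}\|$, and let $\tilde J_k$ be the $m\times n$ matrix whose $i$-th row is the transpose of $$\nabla\tilde r_i(x_k)=\frac nb\sum_{j=1}^b\frac{r_i(x_k+\gamma_ku_j)-r_i(x_k)}{\gamma_k}\,u_j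 .$$ Let $g_k=\tilde J_k^Tr(x_k)$ be the gradient model. If $\|g_k\|\le\varepsilon_0$, stop. Otherwise let $d_k$ solve $(\tilde J_k^T\tilde J_k+\theta_k\|g_k\|I)d=-g_k$ and let $$\rho_k=\frac{\|r(x_k)\|^2-\|r(x_k+d_k)\|^2}{\|r(x_k)\|^2-\|r(x_k)+\tilde J_kd_k\|^2}.$$ Put $x_{k+1}=x_k+d_k$ if $\rho_k\ge p_0$ and $x_{k+1}=x_k$ otherwise. Put $\theta_{k+1}=a_1\theta_k$ if $\rho_k<p_0$ or $\|g_k\|<p_1/\theta_k$; otherwise put $\theta_{k+1}=\theta_k$ if $\|g_k\|<p_2/\theta_k$, and $\theta_{k+1}=\max\{a_2\theta_k,\theta_{\min}\}$ if $\|g_k\|\ge p_2/\theta_k$. (Convention: once the algorithm has stopped, the iterate, the parameter and the last computed step are kept forever, while directions continue to be drawn and the gradient model continues to be formed from them at the kept iterate with the kept radius, so that $x_k$, $d_{k-1}$ and $g_k$ are defined for all $k$.) **Theorem.** Let $\mathcal F_{k-1}$ be the $\sigma$-algebra generated by the directions drawn in the iterations before the $k$-th. If $\alpha\in(0,1)$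 and $b\ge n/2$, then the gradient models are $\alpha$-probabilistically $(\xi_1,\xi_2)$-first-order accurate, i.e. for every $k$, almost surely, $$\mathbb P\Big(\|g_k-\nabla f(x_k)\|\le\xi_1\|\nabla f(x_k)\|+\xi_2\|d_{k-1}\|\ \Big|\ \mathcal F_{k-1}\Big)\ge\alpha,$$ with $$\xi_1=\Big(\frac{n/b-1}{1-\alpha}\Big)^{1/2},\qquad \xi_2=\sqrt m\,\kappa_{\max}\Big(\frac n{2(1-\alpha)^{1/2}}+1\Big)\|r_0\|.$$ -/

import Mathlib

open MeasureTheory ProbabilityTheory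
open scoped Matrix

noncomputable section

namespace OrthLM

/-- Real matrices carry their Borel σ-algebra. -/
instance instMeasurableSpaceMatrix (p q : ℕ) : MeasurableSpace (Matrix (Fin p) (Fin q) ℝ) :=
  borel _

instance instBorelSpaceMatrix (p q : ℕ) : BorelSpace (Matrix (Fin p) (Fin q) ℝ) := ⟨rfl⟩

/-- The Stiefel manifold `St(n, b)` of `n × b` real matrices with `Uᵀ U = I`. -/
def stiefel (n b : ℕ) : Set (Matrix (Fin n) (Fin b) ℝ) := {U | Uᵀ * U = 1}

/-- The direction `u_j`: the `j`-th column of a point of the Stiefel manifold. -/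
def column {n b : ℕ} (U : stiefel n b) (j : Fin b) : EuclideanSpace ℝ (Fin n) :=
  WithLp.toLp 2 (fun i => U.1 i j)

/-- The orthogonal group `O(n)` is compact (needed for its normalized Haar measure). -/
instance instCompactSpaceOrthogonalGroup (n : ℕ) :
    CompactSpace (Matrix.orthogonalGroup (Fin n) ℝ) := by
  have hsub : ((Matrix.orthogonalGroup (Fin n) ℝ : Set (Matrix (Fin n) (Fin n) ℝ))) ⊆
      Set.pi Set.univ (fun _ => Set.pi Set.univ (fun _ => Set.Icc (-1 : ℝ) 1)) := by
    intro Q hQ i _ j _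
    have := entry_norm_bound_of_unitary hQ i j
    rwa [Real.norm_eq_abs, abs_le] at this
  have hcl : IsClosed ((Matrix.orthogonalGroup (Fin n) ℝ : Set (Matrix (Fin n) (Fin n) ℝ))) :=
    isClosed_unitary
  exact isCompact_iff_compactSpace.mp
    ((isCompact_univ_pi fun _ => isCompact_univ_pi fun _ => isCompact_Icc).of_isClosed_subset
      hcl hsub)

/-- The first `b` columns of an orthogonal `n × n` matrix, as a point of `St(n, b)`. -/
def firstColumns {n b : ℕ} (h : b ≤ n) (Q : Matrix.orthogonalGroup (Fin n) ℝ) : stiefel n b :=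
  ⟨Q.1.submatrix id (Fin.castLE h), by
    have hQ : Q.1ᵀ * Q.1 = 1 := (Matrix.mem_orthogonalGroup_iff' (Fin n) ℝ).1 Q.2
    change (Q.1.submatrix id (Fin.castLE h))ᵀ * Q.1.submatrix id (Fin.castLE h) = 1
    rw [Matrix.transpose_submatrix, ← Matrix.submatrix_mul _ _ _ _ _ Function.bijective_id, hQ,
      Matrix.submatrix_one _ (Fin.castLE_injective h)]⟩

/-- The uniform distribution on the Stiefel manifold: the image of the Haar probability measure of
`O(n)` under `Q ↦ (first b columns of Q)`, i.e. the `O(n)`-invariant probability measure on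
`St(n, b)`. -/
def stiefelUniform {n b : ℕ} (h : b ≤ n) : Measure (stiefel n b) :=
  (Measure.haarMeasure (⊤ : TopologicalSpace.PositiveCompacts (Matrix.orthogonalGroup (Fin n) ℝ))).map
    (firstColumns h)

section Model

variable {n m b : ℕ} (r : EuclideanSpace ℝ (Fin n) → EuclideanSpace ℝ (Fin m))

/-- The least squares objective `f(x) = ½ ‖r(x)‖²`. -/
def objective (x : EuclideanSpace ℝ (Fin n)) : ℝ := (1 / 2) * ‖r x‖ ^ 2

/-- The spherical smoothing estimate of `∇ rᵢ(x)`: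
`(n / b) ∑ⱼ ((rᵢ(x + γ uⱼ) - rᵢ(x)) / γ) uⱼ`. -/
def smoothedGradient (γ : ℝ) (U : stiefel n b) (x : EuclideanSpace ℝ (Fin n)) (i : Fin m) :
    EuclideanSpace ℝ (Fin n) :=
  ((n : ℝ) / b) • ∑ j : Fin b, ((r (x + γ • column U j) i - r x i) / γ) • column U j

/-- The Jacobian model: the `m × n` matrix whose `i`-th row is the estimate of `∇ rᵢ(x)`. -/
def jacobianModel (γ : ℝ) (U : stiefel n b) (x : EuclideanSpace ℝ (Fin n)) :
    Matrix (Fin m) (Fin n) ℝ :=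
  Matrix.of fun i l => smoothedGradient r γ U x i l

/-- Matrix-vector product between Euclidean spaces. -/
def mulE {p q : ℕ} (A : Matrix (Fin p) (Fin q) ℝ) (v : EuclideanSpace ℝ (Fin q)) :
    EuclideanSpace ℝ (Fin p) :=
  WithLp.toLp 2 (A *ᵥ v.ofLp)

/-- The gradient model `J̃(x)ᵀ r(x)`. -/
def gradientModel (γ : ℝ) (U : stiefel n b) (x : EuclideanSpace ℝ (Fin n)) :
    EuclideanSpace ℝ (Fin n) :=
  mulE (jacobianModel r γ U x)ᵀ (r x)

/-- The Levenberg-Marquardt step: the solution `d` of `(Jᵀ J + lam I) d = -Jᵀ v`. The algorithm uses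
it only with `lam > 0`, when the matrix is positive definite. -/
def lmStep (J : Matrix (Fin m) (Fin n) ℝ) (lam : ℝ) (v : EuclideanSpace ℝ (Fin m)) :
    EuclideanSpace ℝ (Fin n) :=
  -mulE (Jᵀ * J + lam • (1 : Matrix (Fin n) (Fin n) ℝ))⁻¹ (mulE Jᵀ v)

/-- The ratio of the actual to the predicted reduction for the step `d` at `x`. -/
def reductionRatio (J : Matrix (Fin m) (Fin n) ℝ) (x d : EuclideanSpace ℝ (Fin n)) : ℝ :=
  (‖r x‖ ^ 2 - ‖r (x + d)‖ ^ 2) / (‖r x‖ ^ 2 - ‖r x + mulE J d‖ ^ 2)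

end Model

/-- The scalar inputs of the algorithm with the constraints imposed on them. -/
structure Params where
  a₁ : ℝ
  a₂ : ℝ
  p₀ : ℝ
  p₁ : ℝ
  p₂ : ℝ
  θinit : ℝ
  θmin : ℝ
  ε₀ : ℝ
  one_lt_a₁ : 1 < a₁
  a₂_lt_one : a₂ < 1
  a₂_pos : 0 < a₂
  a₁_mul_a₂_lt_one : a₁ * a₂ < 1
  p₀_pos : 0 < p₀
  p₀_lt_one : p₀ < 1
  p₀_lt_p₁ : p₀ < p₁
  p₁_lt_p₂ : p₁ < p₂
  θmin_pos : 0 < θmin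
  θmin_le : θmin ≤ θinit
  ε₀_nonneg : 0 ≤ ε₀

/-- The state of the algorithm at the beginning of iteration `k`: the iterate `x_k`, the parameter
`θ_k`, the previous step `d_{k-1}`, and whether the algorithm has already stopped. -/
structure State (n : ℕ) where
  x : EuclideanSpace ℝ (Fin n)
  θ : ℝ
  dPrev : EuclideanSpace ℝ (Fin n)
  stopped : Bool

section Algorithm

variable {n m b : ℕ} (par : Params) (r : EuclideanSpace ℝ (Fin n) → EuclideanSpace ℝ (Fin m))

/-- The update of `θ`, given the ratio `ρ` and the norm `g` of the gradient model. -/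
def updateTheta (θ ρ g : ℝ) : ℝ :=
  if ρ < par.p₀ then par.a₁ * θ
  else if g < par.p₁ / θ then par.a₁ * θ
  else if g < par.p₂ / θ then θ
  else max (par.a₂ * θ) par.θmin

/-- One iteration with the directions `U` and the smoothing radius `γ = ‖d_{k-1}‖`. Once the
algorithm has stopped, the state is never changed again. -/
def step (U : stiefel n b) (s : State n) : State n :=
  let J := jacobianModel r ‖s.dPrev‖ U s.x
  let g := ‖gradientModel r ‖s.dPrev‖ U s.x‖
  if s.stopped = true ∨ g ≤ par.ε₀ then { s with stopped := true }
  else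
    let d := lmStep J (s.θ * g) (r s.x)
    let ρ := reductionRatio r J s.x d
    { x := if par.p₀ ≤ ρ then s.x + d else s.x
      θ := updateTheta par s.θ ρ g
      dPrev := d
      stopped := false }

/-- The run of the algorithm from `x₀`, with `dInit` in the role of `d_{-1}` (so that the first
smoothing radius is `‖dInit‖`), when `U k` is the frame of directions drawn in iteration `k`. -/
def run (x₀ dInit : EuclideanSpace ℝ (Fin n)) (U : ℕ → stiefel n b) : ℕ → State n
  | 0 => { x := x₀, θ := par.θinit, dPrev := dInit, stopped := false }
  | k + 1 => step par r (U k) (run x₀ dInit U k)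

end Algorithm

/-- The σ-algebra `𝓕_{k-1}` generated by the directions drawn in the iterations before the `k`-th. -/
abbrev pastSigma {Ω : Type*} {n b : ℕ} (U : ℕ → Ω → stiefel n b) (k : ℕ) : MeasurableSpace Ω :=
  ⨆ j : Fin k, MeasurableSpace.comap (U j) inferInstance

/-- The models `G k` of `∇f (X k)` are `α`-probabilistically `(ξ₁, ξ₂)`-first-order accurate. Here
`past k` is the σ-algebra `𝓕_{k-1}` of what happened before iteration `k`, and `Dprev k` is the step
`D_{k-1}` preceding iteration `k`. -/
def ProbFirstOrderAccurate {Ω : Type*} [MeasurableSpace Ω] (P : Measure Ω) {n : ℕ}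
    (f : EuclideanSpace ℝ (Fin n) → ℝ) (past : ℕ → MeasurableSpace Ω)
    (X Dprev G : ℕ → Ω → EuclideanSpace ℝ (Fin n)) (α ξ₁ ξ₂ : ℝ) : Prop :=
  ∀ k : ℕ, ∀ᵐ ω ∂P,
    α ≤ (P⟦{ω' | ‖G k ω' - gradient f (X k ω')‖ ≤
      ξ₁ * ‖gradient f (X k ω')‖ + ξ₂ * ‖Dprev k ω'‖} | past k⟧) ω

end OrthLM

end

/-! Fix an iterate $x$ and a radius $\gamma>0$. The gradient model is $(n/b)\sum_j c_ju_j$ with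
$c_j=\langle r(x),r(x+\gamma u_j)-r(x)\rangle/\gamma$, and Taylor's formula puts $c_j$ within
$O(\gamma)$ of $\langle u_j,\nabla f(x)\rangle$. So the model is the rescaled projection of $\nabla
f(x)$ onto the span of the frame, up to an error that is $O(\gamma)$ for every frame
(`norm_gradientModel_sub_scaledProjection_le`).

Only the projection error is random. By invariance each $\langle u_j,v\rangle^2$ has mean
$\|v\|^2/n$, so $\|(n/b)\Pi v-v\|^2$ has mean $(n/b-1)\|v\|^2$, where $\Pi$ projects onto the span,
and Markov's inequality yields $\xi_1$.

Along a run, $\|r(x_k)\|\le\|r_0\|$ because accepted steps do not increase the residual, and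
$d_{k-1}\ne0$ keeps the radius positive (`run_valid`). Finally $(x_k,d_{k-1})$ is determined by the
past and $U_k$ is independent of it, so the fixed-iterate bound passes to the conditional
probability (`ae_le_condProb_of_indep`). -/

noncomputable section

namespace OrthLM

/-! ### Second moments of uniform frames and the projection error -/

section Uniform

variable {n b : ℕ}

/-- The normalized Haar measure of `O(n)`. -/
abbrev orthogonalHaar (n : ℕ) : Measure (Matrix.orthogonalGroup (Fin n) ℝ) :=
  Measure.haarMeasure (⊤ : TopologicalSpace.PositiveCompacts (Matrix.orthogonalGroup (Fin n) ℝ))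

instance instIsProbabilityMeasureOrthogonalHaar (n : ℕ) :
    IsProbabilityMeasure (orthogonalHaar n) :=
  ⟨by
    simpa using @Measure.haarMeasure_self _ _ _ _ _ _
      (⊤ : TopologicalSpace.PositiveCompacts (Matrix.orthogonalGroup (Fin n) ℝ))⟩

/-- Compactness forces unimodularity: a right translate is again a Haar probability measure, and
that is unique. -/
instance instIsMulRightInvariantOrthogonalHaar (n : ℕ) :
    (orthogonalHaar n).IsMulRightInvariant := by
  refine ⟨fun g => ?_⟩
  have : IsProbabilityMeasure ((orthogonalHaar n).map (· * g)) :=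
    Measure.isProbabilityMeasure_map (by fun_prop)
  exact Measure.isHaarMeasure_eq_of_isProbabilityMeasure _ _

/-- A permutation matrix as an orthogonal matrix. -/
def permOrthogonal (σ : Equiv.Perm (Fin n)) : Matrix.orthogonalGroup (Fin n) ℝ :=
  ⟨σ.permMatrix ℝ, by
    rw [Matrix.mem_orthogonalGroup_iff, Matrix.transpose_permMatrix, ← Matrix.permMatrix_mul]
    simp⟩

lemma mul_permOrthogonal_apply (Q : Matrix.orthogonalGroup (Fin n) ℝ) (σ : Equiv.Perm (Fin n))
    (i j : Fin n) : (Q * permOrthogonal σ).1 i j = Q.1 i (σ.symm j) := by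
  change (Q.1 * σ.permMatrix ℝ) i j = _
  simp [Equiv.Perm.permMatrix, PEquiv.mul_toMatrix_toPEquiv]

lemma continuous_orthogonal_entry (i j : Fin n) :
    Continuous fun Q : Matrix.orthogonalGroup (Fin n) ℝ => Q.1 i j :=
  continuous_subtype_val.matrix_elem i j

lemma continuous_firstColumns (h : b ≤ n) : Continuous (firstColumns h) :=
  (continuous_subtype_val.matrix_submatrix _ _).subtype_mk _

instance instIsProbabilityMeasureStiefelUniform (h : b ≤ n) :
    IsProbabilityMeasure (stiefelUniform h) :=
  Measure.isProbabilityMeasure_map (continuous_firstColumns h).measurable.aemeasurable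

/-- Right multiplication by a transposition swaps columns, so the integral does not depend on $j$;
the sum over $j$ is $\|Q^Tv\|^2=\|v\|^2$. -/
lemma integral_orthogonal_column_sq (v : Fin n → ℝ) (j : Fin n) :
    ∫ Q, (∑ i, Q.1 i j * v i) ^ 2 ∂(orthogonalHaar n) = (∑ i, v i ^ 2) / n := by
  have hint : ∀ j : Fin n, Integrable (fun Q : Matrix.orthogonalGroup (Fin n) ℝ =>
      (∑ i, Q.1 i j * v i) ^ 2) (orthogonalHaar n) := fun j =>
    ((continuous_finsetSum _ fun i _ =>
      (continuous_orthogonal_entry i j).mul continuous_const).pow 2).integrable_of_hasCompactSupport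
        (HasCompactSupport.of_compactSpace _)
  have hsum : ∀ Q : Matrix.orthogonalGroup (Fin n) ℝ,
      ∑ j, (∑ i, Q.1 i j * v i) ^ 2 = ∑ i, v i ^ 2 := by
    intro Q
    have hQ : Q.1 * Q.1ᵀ = 1 := (Matrix.mem_orthogonalGroup_iff (Fin n) ℝ).1 Q.2
    have h1 : (v ᵥ* Q.1) ⬝ᵥ (v ᵥ* Q.1) = v ⬝ᵥ v := by
      conv_lhs => rw [← Matrix.dotProduct_mulVec, ← Matrix.mulVec_transpose,
        Matrix.mulVec_mulVec, hQ, Matrix.one_mulVec]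
    simpa [dotProduct, Matrix.vecMul, sq, mul_comm] using h1
  have heq : ∀ j' : Fin n, ∫ Q, (∑ i, Q.1 i j' * v i) ^ 2 ∂(orthogonalHaar n)
      = ∫ Q, (∑ i, Q.1 i j * v i) ^ 2 ∂(orthogonalHaar n) := by
    intro j'
    rw [← integral_mul_right_eq_self _ (permOrthogonal (Equiv.swap j j'))]
    simp only [mul_permOrthogonal_apply, Equiv.symm_swap, Equiv.swap_apply_right]
  have htot : ∑ j', ∫ Q, (∑ i, Q.1 i j' * v i) ^ 2 ∂(orthogonalHaar n) = ∑ i, v i ^ 2 := by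
    rw [← integral_finsetSum _ fun j _ => hint j]
    simp [hsum]
  simp only [heq, Finset.sum_const, Finset.card_univ, Fintype.card_fin, nsmul_eq_mul] at htot
  have hn : (n : ℝ) ≠ 0 := by
    have := j.pos
    positivity
  rw [← htot]
  field_simp

lemma inner_column (U : stiefel n b) (j : Fin b) (v : EuclideanSpace ℝ (Fin n)) :
    inner ℝ (column U j) v = ∑ i, U.1 i j * v i := by
  simp [column, PiLp.inner_apply, mul_comm]

lemma orthonormal_column (U : stiefel n b) : Orthonormal ℝ (column U) := by
  rw [orthonormal_iff_ite]
  intro i j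
  have h : (U.1ᵀ * U.1) i j = (1 : Matrix (Fin b) (Fin b) ℝ) i j := by rw [U.2]
  rw [inner_column]
  simpa [Matrix.mul_apply, Matrix.one_apply, column] using h

lemma continuous_column (j : Fin b) : Continuous fun U : stiefel n b => column U j :=
  (PiLp.continuous_toLp 2 _).comp
    (continuous_pi fun i => continuous_subtype_val.matrix_elem i j)

lemma norm_sum_smul_column_sq (U : stiefel n b) (c : Fin b → ℝ) :
    ‖∑ j, c j • column U j‖ ^ 2 = ∑ j, c j ^ 2 := by
  rw [← real_inner_self_eq_norm_sq, (orthonormal_column U).inner_sum]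
  simp [sq]

/-- The rescaled projection `(n / b) ∑ⱼ ⟪uⱼ, v⟫ uⱼ` of `v`. -/
def scaledProjection (U : stiefel n b) (v : EuclideanSpace ℝ (Fin n)) :
    EuclideanSpace ℝ (Fin n) :=
  ((n : ℝ) / b) • ∑ j, (inner ℝ (column U j) v : ℝ) • column U j

lemma norm_scaledProjection_sub_sq (U : stiefel n b) (v : EuclideanSpace ℝ (Fin n)) :
    ‖scaledProjection U v - v‖ ^ 2 =
      (((n : ℝ) / b) ^ 2 - 2 * (n / b)) * ∑ j, (inner ℝ (column U j) v : ℝ) ^ 2 + ‖v‖ ^ 2 := by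
  have h : (inner ℝ (∑ j, (inner ℝ (column U j) v : ℝ) • column U j) v : ℝ)
      = ∑ j, (inner ℝ (column U j) v : ℝ) ^ 2 := by
    simp [sum_inner, real_inner_smul_left, sq]
  rw [norm_sub_sq_real, scaledProjection, norm_smul, mul_pow, norm_sum_smul_column_sq,
    real_inner_smul_left, h, Real.norm_eq_abs, sq_abs]
  ring

lemma continuous_scaledProjection (v : EuclideanSpace ℝ (Fin n)) :
    Continuous fun U : stiefel n b => scaledProjection U v := by
  have h := continuous_column (n := n) (b := b)
  unfold scaledProjection
  fun_prop

lemma integrable_comp_firstColumns (h : b ≤ n) {φ : stiefel n b → ℝ} (hφ : Continuous φ) :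
    Integrable (fun Q => φ (firstColumns h Q)) (orthogonalHaar n) :=
  (hφ.comp (continuous_firstColumns h)).integrable_of_hasCompactSupport
    (HasCompactSupport.of_compactSpace _)

lemma integrable_stiefelUniform (h : b ≤ n) {φ : stiefel n b → ℝ} (hφ : Continuous φ) :
    Integrable φ (stiefelUniform h) :=
  (integrable_map_measure hφ.aestronglyMeasurable
    (continuous_firstColumns h).measurable.aemeasurable).2 (integrable_comp_firstColumns h hφ)

lemma integral_stiefelUniform (h : b ≤ n) {φ : stiefel n b → ℝ} (hφ : Continuous φ) :
    ∫ U, φ U ∂(stiefelUniform h) = ∫ Q, φ (firstColumns h Q) ∂(orthogonalHaar n) :=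
  integral_map (continuous_firstColumns h).measurable.aemeasurable hφ.aestronglyMeasurable

/-- The squared projection has mean $(b/n)\|v\|^2$, and $((n/b)^2-2n/b)(b/n)+1=n/b-1$. -/
lemma integral_norm_scaledProjection_sub_sq (hb : 1 ≤ b) (h : b ≤ n)
    (v : EuclideanSpace ℝ (Fin n)) :
    ∫ U, ‖scaledProjection U v - v‖ ^ 2 ∂(stiefelUniform h) = ((n : ℝ) / b - 1) * ‖v‖ ^ 2 := by
  have hc : ∀ j, Continuous fun U : stiefel n b => (inner ℝ (column U j) v : ℝ) ^ 2 :=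
    fun j => ((continuous_column j).inner continuous_const).pow 2
  have hj : ∀ j, ∫ U, (inner ℝ (column U j) v : ℝ) ^ 2 ∂(stiefelUniform h) = ‖v‖ ^ 2 / n := by
    intro j
    rw [integral_stiefelUniform h (hc j), EuclideanSpace.real_norm_sq_eq,
      ← integral_orthogonal_column_sq _ (Fin.castLE h j)]
    simp only [inner_column]
    rfl
  simp only [norm_scaledProjection_sub_sq]
  rw [integral_add ((integrable_finsetSum _ fun j _ =>
      integrable_stiefelUniform h (hc j)).const_mul _) (integrable_const _),
    integral_const_mul, integral_finsetSum _ fun j _ => integrable_stiefelUniform h (hc j)]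
  simp only [hj, Finset.sum_const, Finset.card_univ, Fintype.card_fin, nsmul_eq_mul,
    integral_const, probReal_univ, one_smul]
  have hb0 : (b : ℝ) ≠ 0 := by positivity
  have hn0 : (n : ℝ) ≠ 0 := by
    have : 0 < n := by omega
    positivity
  field_simp
  ring

/-- Markov's inequality in the form `α ≤ μ {X ≤ c}`, valid also for `c = 0`. -/
lemma le_measureReal_le_of_integral_le {S : Type*} [MeasurableSpace S] {μ : Measure S}
    [IsProbabilityMeasure μ] {X : S → ℝ} (hX : Measurable X) (hX0 : ∀ s, 0 ≤ X s)
    (hXi : Integrable X μ) {α c : ℝ} (hc : 0 ≤ c) (hα1 : α ≤ 1)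
    (hE : ∫ s, X s ∂μ ≤ (1 - α) * c) : α ≤ μ.real {s | X s ≤ c} := by
  rcases hc.eq_or_lt with rfl | hc
  -- The case $c=0$ arises when $b=n$ or $v=0$; a nonnegative variable with zero mean vanishes
  -- almost surely.
  · have h0 : ∫ s, X s ∂μ = 0 :=
      le_antisymm (by simpa using hE) (integral_nonneg hX0)
    have h1 : X =ᵐ[μ] 0 := (integral_eq_zero_iff_of_nonneg hX0 hXi).1 h0
    have h2 : μ.real {s | X s ≤ 0} = 1 := by
      rw [← probReal_univ (μ := μ)]
      refine measureReal_congr ?_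
      filter_upwards [h1] with s hs
      have : X s ≤ 0 := hs.le
      exact propext ⟨fun _ => trivial, fun _ => this⟩
    rw [h2]
    exact hα1
  · have hM := mul_meas_ge_le_integral_of_nonneg (Filter.Eventually.of_forall hX0) hXi c
    have h1 : μ.real {s | c ≤ X s} ≤ 1 - α := by
      have := hM.trans hE
      rw [mul_comm] at this
      exact le_of_mul_le_mul_right this hc
    have h2 : μ.real {s | X s ≤ c}ᶜ ≤ μ.real {s | c ≤ X s} :=
      measureReal_mono fun s (hs : ¬ X s ≤ c) => (not_le.1 hs).le
    rw [probReal_compl_eq_one_sub (measurableSet_le hX measurable_const)] at h2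
    linarith

lemma le_prob_norm_scaledProjection_sub_le (hb : 1 ≤ b) (h : b ≤ n)
    (v : EuclideanSpace ℝ (Fin n)) {α : ℝ} (hα₁ : α < 1) :
    α ≤ (stiefelUniform h).real {U | ‖scaledProjection U v - v‖ ≤
      Real.sqrt (((n : ℝ) / b - 1) / (1 - α)) * ‖v‖} := by
  have hα : 0 < 1 - α := by linarith
  have hb0 : (0 : ℝ) < b := by positivity
  have hnb : 0 ≤ (n : ℝ) / b - 1 := by
    rw [sub_nonneg, le_div_iff₀ hb0, one_mul]
    exact_mod_cast h
  have hcont : Continuous fun U : stiefel n b => ‖scaledProjection U v - v‖ ^ 2 :=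
    ((continuous_scaledProjection v).sub continuous_const).norm.pow 2
  have key := le_measureReal_le_of_integral_le (μ := stiefelUniform h) hcont.measurable
    (fun U => sq_nonneg _) (integrable_stiefelUniform h hcont) (α := α)
    (c := ((n : ℝ) / b - 1) / (1 - α) * ‖v‖ ^ 2) (by positivity) hα₁.le (by
      rw [integral_norm_scaledProjection_sub_sq hb h]
      apply le_of_eq
      field_simp)
  refine key.trans (measureReal_mono fun U hU => ?_)
  rw [Set.mem_ofPred_eq]
  refine le_of_sq_le_sq ?_ ?_
  swap; · positivity
  rw [mul_pow, Real.sq_sqrt (by positivity)]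
  exact hU

end Uniform

/-! ### Taylor estimate with Lipschitz gradient -/

section Taylor

variable {E : Type*} [NormedAddCommGroup E] [InnerProductSpace ℝ E] [CompleteSpace E]

/-- First-order Taylor estimate for a function with Lipschitz gradient. -/
lemma abs_sub_sub_inner_gradient_le {g : E → ℝ} (hg : Differentiable ℝ g) {κ : ℝ}
    (hκ : ∀ x y, ‖gradient g x - gradient g y‖ ≤ κ * ‖x - y‖) (x h : E) :
    |g (x + h) - g x - inner ℝ (gradient g x) h| ≤ κ / 2 * ‖h‖ ^ 2 := by
  have hd : ∀ t : ℝ, HasDerivAt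
      (fun t : ℝ => g (x + t • h) - g x - t * inner ℝ (gradient g x) h)
      (inner ℝ (gradient g (x + t • h)) h - inner ℝ (gradient g x) h) t := by
    intro t
    have h1 : HasDerivAt (fun t : ℝ => x + t • h) h t := by
      simpa using ((hasDerivAt_id t).smul_const h).const_add x
    have h2 := (hg (x + t • h)).hasFDerivAt.comp_hasDerivAt t h1
    rw [← inner_gradient_left] at h2
    exact ((h2.sub_const (g x)).sub
      ((hasDerivAt_id t).mul_const (inner ℝ (gradient g x) h))).congr_deriv (by rw [one_mul])
  have hB : ∀ t : ℝ, HasDerivAt (fun t : ℝ => κ / 2 * ‖h‖ ^ 2 * t ^ 2) (κ * ‖h‖ ^ 2 * t) t := by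
    intro t
    exact ((hasDerivAt_pow 2 t).const_mul (κ / 2 * ‖h‖ ^ 2)).congr_deriv (by
      push_cast
      ring)
  -- The remainder along the segment is compared with $\tfrac{\kappa}{2}\|h\|^2t^2$ through their
  -- derivatives on $[0,1]$.
  have key := image_norm_le_of_norm_deriv_right_le_deriv_boundary (a := 0) (b := 1)
    (fun t _ => (hd t).continuousAt.continuousWithinAt)
    (fun t _ => (hd t).hasDerivWithinAt) (by simp) hB (by
      intro t ht
      rw [← inner_sub_left]
      refine (norm_inner_le_norm _ _).trans ?_
      have h1 := hκ (x + t • h) x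
      rw [add_sub_cancel_left, norm_smul, Real.norm_eq_abs, abs_of_nonneg ht.1] at h1
      have := mul_le_mul_of_nonneg_right h1 (norm_nonneg h)
      refine this.trans (le_of_eq ?_)
      ring) (Set.right_mem_Icc.2 zero_le_one)
  simpa using key

end Taylor

/-! ### Finite-difference error of the gradient model -/

section Error

variable {n m b : ℕ} {r : EuclideanSpace ℝ (Fin n) → EuclideanSpace ℝ (Fin m)}

lemma fderiv_coord (hr : Differentiable ℝ r) (x h : EuclideanSpace ℝ (Fin n)) (i : Fin m) :
    fderiv ℝ r x h i = inner ℝ (gradient (fun z => r z i) x) h := by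
  have h1 : HasFDerivAt (fun z => r z i)
      ((EuclideanSpace.proj i : EuclideanSpace ℝ (Fin m) →L[ℝ] ℝ).comp (fderiv ℝ r x)) x :=
    (EuclideanSpace.proj i : EuclideanSpace ℝ (Fin m) →L[ℝ] ℝ).hasFDerivAt.comp x
      (hr x).hasFDerivAt
  rw [inner_gradient_left, h1.fderiv]
  rfl

lemma norm_le_sqrt_mul_of_forall_abs_le {c : ℝ} (hc : 0 ≤ c) (e : EuclideanSpace ℝ (Fin m))
    (he : ∀ i, |e i| ≤ c) : ‖e‖ ≤ Real.sqrt m * c := by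
  refine le_of_sq_le_sq ?_ ?_
  swap; · positivity
  rw [EuclideanSpace.real_norm_sq_eq, mul_pow, Real.sq_sqrt (Nat.cast_nonneg m)]
  calc ∑ i, e i ^ 2 ≤ ∑ _i : Fin m, c ^ 2 :=
        Finset.sum_le_sum fun i _ => sq_le_sq.2 ((he i).trans (le_abs_self c))
    _ = m * c ^ 2 := by simp

lemma norm_taylor_remainder_le (hr : Differentiable ℝ r) {κ : Fin m → ℝ} (hκpos : ∀ i, 0 < κ i)
    (hκ : ∀ i x y,
      ‖gradient (fun z => r z i) x - gradient (fun z => r z i) y‖ ≤ κ i * ‖x - y‖)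
    (x h : EuclideanSpace ℝ (Fin n)) :
    ‖r (x + h) - r x - fderiv ℝ r x h‖ ≤ Real.sqrt m * ((⨆ i, κ i) / 2 * ‖h‖ ^ 2) := by
  have hsup : 0 ≤ ⨆ i, κ i := Real.iSup_nonneg fun i => (hκpos i).le
  refine norm_le_sqrt_mul_of_forall_abs_le (by positivity) _ fun i => ?_
  have hd : Differentiable ℝ fun z => r z i := fun z =>
    ((EuclideanSpace.proj i : EuclideanSpace ℝ (Fin m) →L[ℝ] ℝ).differentiableAt.comp z (hr z))
  have h1 := abs_sub_sub_inner_gradient_le hd (hκ i) x h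
  have h2 : κ i ≤ ⨆ i, κ i := le_ciSup (Set.finite_range κ).bddAbove i
  simp only [PiLp.sub_apply, fderiv_coord hr]
  refine h1.trans ?_
  gcongr

lemma inner_gradient_objective (hr : Differentiable ℝ r) (x h : EuclideanSpace ℝ (Fin n)) :
    inner ℝ (gradient (objective r) x) h = inner ℝ (r x) (fderiv ℝ r x h) := by
  have h1 : HasFDerivAt (objective r)
      ((1 / 2 : ℝ) • (2 • (innerSL ℝ (r x)).comp (fderiv ℝ r x))) x :=
    ((hr x).hasFDerivAt.norm_sq).const_mul (1 / 2)
  rw [inner_gradient_left, h1.fderiv]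
  simp

/-- Exchanging the sums over residual components and directions gives the model the shape of
`scaledProjection`, so that the two compare coefficient by coefficient. -/
lemma gradientModel_eq (γ : ℝ) (U : stiefel n b) (x : EuclideanSpace ℝ (Fin n)) :
    gradientModel r γ U x =
      ((n : ℝ) / b) • ∑ j, (inner ℝ (r x) (r (x + γ • column U j) - r x) / γ) • column U j := by
  ext l
  simp only [gradientModel, mulE, jacobianModel, smoothedGradient, Matrix.mulVec, dotProduct,
    Matrix.transpose_apply, Matrix.of_apply, PiLp.smul_apply, WithLp.ofLp_sum, Finset.sum_apply,
    WithLp.ofLp_smul, Pi.smul_apply, smul_eq_mul, PiLp.inner_apply, PiLp.sub_apply,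
    RCLike.inner_apply, conj_trivial, Finset.mul_sum, Finset.sum_mul, Finset.sum_div]
  rw [Finset.sum_comm]
  refine Finset.sum_congr rfl fun j _ => Finset.sum_congr rfl fun i _ => ?_
  ring

/-- The error of the gradient model, apart from that of the projection of the gradient. -/
lemma norm_gradientModel_sub_scaledProjection_le (hr : Differentiable ℝ r) {κ : Fin m → ℝ}
    (hκpos : ∀ i, 0 < κ i)
    (hκ : ∀ i x y,
      ‖gradient (fun z => r z i) x - gradient (fun z => r z i) y‖ ≤ κ i * ‖x - y‖)
    (hb : 1 ≤ b) {γ : ℝ} (hγ : 0 < γ) (U : stiefel n b) (x : EuclideanSpace ℝ (Fin n)) :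
    ‖gradientModel r γ U x - scaledProjection U (gradient (objective r) x)‖ ≤
      Real.sqrt m * (⨆ i, κ i) * (n / 2) * ‖r x‖ * γ := by
  have hsup : 0 ≤ ⨆ i, κ i := Real.iSup_nonneg fun i => (hκpos i).le
  have hb1 : (1 : ℝ) ≤ b := by exact_mod_cast hb
  set C : ℝ := Real.sqrt m * ((⨆ i, κ i) / 2) * ‖r x‖ * γ with hC
  have hC0 : 0 ≤ C := by positivity
  have hc : ∀ j, |inner ℝ (r x) (r (x + γ • column U j) - r x) / γ -
      inner ℝ (column U j) (gradient (objective r) x)| ≤ C := by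
    intro j
    -- Since $\langle\nabla f(x),u\rangle=\langle r(x),J(x)u\rangle$, the linear part cancels and
    -- only the Taylor remainder is left.
    have h1 : inner ℝ (r x) (r (x + γ • column U j) - r x) / γ -
        inner ℝ (column U j) (gradient (objective r) x) =
        inner ℝ (r x) (r (x + γ • column U j) - r x - fderiv ℝ r x (γ • column U j)) / γ := by
      rw [real_inner_comm (gradient _ _), inner_gradient_objective hr, inner_sub_right _ (_ - _), map_smul,
        real_inner_smul_right]
      field_simp
    have h2 := norm_taylor_remainder_le hr hκpos hκ x (γ • column U j)
    rw [norm_smul, (orthonormal_column U).1 j, mul_one, Real.norm_eq_abs, sq_abs] at h2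
    rw [h1, abs_div, abs_of_pos hγ, div_le_iff₀ hγ]
    refine (abs_real_inner_le_norm _ _).trans ?_
    refine (mul_le_mul_of_nonneg_left h2 (norm_nonneg _)).trans (le_of_eq ?_)
    rw [hC]
    ring
  rw [gradientModel_eq, scaledProjection, ← smul_sub, ← Finset.sum_sub_distrib]
  simp only [← sub_smul]
  rw [norm_smul, Real.norm_eq_abs, abs_of_nonneg (by positivity)]
  -- The triangle inequality suffices: its factor $b$ cancels against $n/b$.
  have h3 : ‖∑ j, (inner ℝ (r x) (r (x + γ • column U j) - r x) / γ -
      inner ℝ (column U j) (gradient (objective r) x)) • column U j‖ ≤ b * C := by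
    refine (norm_sum_le _ _).trans ?_
    calc _ ≤ ∑ _j : Fin b, C := Finset.sum_le_sum fun j _ => by
            rw [norm_smul, (orthonormal_column U).1 j, mul_one]
            exact hc j
      _ = b * C := by simp
  calc (n : ℝ) / b * _ ≤ n / b * (b * C) := by gcongr
    _ = _ := by
      rw [hC]
      field_simp

end Error

/-! ### Invariants of the Levenberg-Marquardt iteration -/

section Step

variable {n m b : ℕ} {r : EuclideanSpace ℝ (Fin n) → EuclideanSpace ℝ (Fin m)}

lemma mulE_mul {p q s : ℕ} (A : Matrix (Fin p) (Fin q) ℝ) (B : Matrix (Fin q) (Fin s) ℝ)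
    (v : EuclideanSpace ℝ (Fin s)) : mulE (A * B) v = mulE A (mulE B v) := by
  simp [mulE, Matrix.mulVec_mulVec]

lemma inner_mulE {p q : ℕ} (A : Matrix (Fin p) (Fin q) ℝ) (v : EuclideanSpace ℝ (Fin q))
    (w : EuclideanSpace ℝ (Fin p)) : inner ℝ w (mulE A v) = inner ℝ (mulE Aᵀ w) v := by
  simp only [mulE, EuclideanSpace.inner_eq_star_dotProduct, star_trivial, Matrix.mulVec_transpose]
  rw [dotProduct_comm, Matrix.dotProduct_mulVec, dotProduct_comm]

lemma isUnit_det_transpose_mul_add_smul (J : Matrix (Fin m) (Fin n) ℝ) {lam : ℝ} (hlam : 0 < lam) :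
    IsUnit (Jᵀ * J + lam • (1 : Matrix (Fin n) (Fin n) ℝ)).det := by
  have h1 : (Jᵀ * J).PosSemidef := by
    simpa using Matrix.posSemidef_conjTranspose_mul_self J
  have h2 : (lam • (1 : Matrix (Fin n) (Fin n) ℝ)).PosDef := Matrix.PosDef.one.smul hlam
  exact (h2.posSemidef_add h1).det_pos.ne'.isUnit

/-- The step solves the regularized normal equations. -/
lemma lmStep_spec (J : Matrix (Fin m) (Fin n) ℝ) {lam : ℝ} (hlam : 0 < lam)
    (v : EuclideanSpace ℝ (Fin m)) :
    mulE Jᵀ (mulE J (lmStep J lam v)) + lam • lmStep J lam v = -mulE Jᵀ v := by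
  have h1 : mulE (Jᵀ * J + lam • (1 : Matrix (Fin n) (Fin n) ℝ)) (lmStep J lam v) =
      -mulE Jᵀ v := by
    simp only [lmStep, mulE, WithLp.ofLp_neg, Matrix.mulVec_neg, Matrix.mulVec_mulVec]
    rw [← Matrix.mul_assoc, Matrix.mul_nonsing_inv _ (isUnit_det_transpose_mul_add_smul J hlam),
      Matrix.one_mul,
      WithLp.toLp_neg]
  rw [← h1, ← mulE_mul]
  simp [mulE, Matrix.add_mulVec, Matrix.smul_mulVec]

/-- Keeps the next smoothing radius positive. -/
lemma lmStep_ne_zero {J : Matrix (Fin m) (Fin n) ℝ} {lam : ℝ} (hlam : 0 < lam)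
    {v : EuclideanSpace ℝ (Fin m)} (hv : mulE Jᵀ v ≠ 0) : lmStep J lam v ≠ 0 := by
  intro h0
  have h := lmStep_spec J hlam v
  rw [h0] at h
  apply hv
  simpa [mulE] using h.symm

/-- The predicted reduction is nonnegative. -/
lemma norm_add_mulE_lmStep_sq_le (J : Matrix (Fin m) (Fin n) ℝ) {lam : ℝ} (hlam : 0 < lam)
    (v : EuclideanSpace ℝ (Fin m)) : ‖v + mulE J (lmStep J lam v)‖ ^ 2 ≤ ‖v‖ ^ 2 := by
  have h := congrArg (fun w => inner ℝ w (lmStep J lam v)) (lmStep_spec J hlam v)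
  simp only [inner_add_left, inner_neg_left, real_inner_smul_left, ← inner_mulE,
    real_inner_self_eq_norm_sq] at h
  rw [norm_add_sq_real]
  -- Pairing the normal equations with $d$ shows that the predicted reduction equals
  -- $\|Jd\|^2+2\lambda\|d\|^2$.
  nlinarith [sq_nonneg ‖mulE J (lmStep J lam v)‖, mul_nonneg hlam.le (sq_nonneg ‖lmStep J lam v‖)]

lemma norm_le_of_pos_reductionRatio {J : Matrix (Fin m) (Fin n) ℝ} {lam : ℝ} (hlam : 0 < lam)
    {x : EuclideanSpace ℝ (Fin n)}
    (hρ : 0 < reductionRatio r J x (lmStep J lam (r x))) :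
    ‖r (x + lmStep J lam (r x))‖ ≤ ‖r x‖ := by
  have hD := sub_nonneg.2 (norm_add_mulE_lmStep_sq_le J hlam (r x))
  refine le_of_sq_le_sq ?_ ?_
  swap; · positivity
  by_contra hlt
  -- A zero denominator is covered too: the ratio is then $0$, hence not positive.
  exact hρ.not_ge (div_nonpos_of_nonpos_of_nonneg (by linarith) hD)

/-- What every iteration preserves. -/
structure State.Valid (r : EuclideanSpace ℝ (Fin n) → EuclideanSpace ℝ (Fin m)) (R : ℝ)
    (s : State n) : Prop where
  θ_pos : 0 < s.θ
  dPrev_ne_zero : s.dPrev ≠ 0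
  norm_le : ‖r s.x‖ ≤ R

lemma updateTheta_pos (par : Params) {θ : ℝ} (hθ : 0 < θ) (ρ g : ℝ) :
    0 < updateTheta par θ ρ g := by
  have h1 : 0 < par.a₁ := zero_lt_one.trans par.one_lt_a₁
  unfold updateTheta
  split_ifs
  · positivity
  · positivity
  · exact hθ
  · exact lt_max_of_lt_right par.θmin_pos

lemma State.Valid.step (par : Params) {R : ℝ} {s : State n} (hs : s.Valid r R)
    (U : stiefel n b) : (step par r U s).Valid r R := by
  unfold OrthLM.step
  by_cases hdone : s.stopped = true ∨ ‖gradientModel r ‖s.dPrev‖ U s.x‖ ≤ par.ε₀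
  · simp only [hdone, if_true]
    exact ⟨hs.θ_pos, hs.dPrev_ne_zero, hs.norm_le⟩
  · simp only [hdone, if_false]
    -- Not stopping means $\|g_k\|>\varepsilon_0\ge0$, so the regularization $\theta_k\|g_k\|$ is
    -- positive.
    have hg : 0 < ‖gradientModel r ‖s.dPrev‖ U s.x‖ :=
      par.ε₀_nonneg.trans_lt (not_le.1 (not_or.1 hdone).2)
    have hlam := mul_pos hs.θ_pos hg
    refine ⟨updateTheta_pos par hs.θ_pos _ _, lmStep_ne_zero hlam (norm_pos_iff.1 hg), ?_⟩
    dsimp only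
    split_ifs with hρ
    · exact (norm_le_of_pos_reductionRatio hlam (par.p₀_pos.trans_le hρ)).trans hs.norm_le
    · exact hs.norm_le

lemma run_valid (par : Params) {x₀ dInit : EuclideanSpace ℝ (Fin n)} (hd : dInit ≠ 0)
    (U : ℕ → stiefel n b) (k : ℕ) : (run par r x₀ dInit U k).Valid r ‖r x₀‖ := by
  induction k with
  | zero => exact ⟨par.θmin_pos.trans_le par.θmin_le, hd, le_rfl⟩
  | succ k ih => exact ih.step par (U k)

end Step

/-! ### Measurability of the run -/

section Measurability

variable {Ω : Type*} [MeasurableSpace Ω] {n m b : ℕ}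
  {r : EuclideanSpace ℝ (Fin n) → EuclideanSpace ℝ (Fin m)}

lemma measurable_euclidean_iff {p : ℕ} {f : Ω → EuclideanSpace ℝ (Fin p)} :
    Measurable f ↔ ∀ i, Measurable fun ω => f ω i := by
  refine ⟨fun h i => ?_, fun h => ?_⟩
  · exact (EuclideanSpace.proj i : EuclideanSpace ℝ (Fin p) →L[ℝ] ℝ).measurable.comp h
  · exact (PiLp.continuous_toLp 2 _).measurable.comp (measurable_pi_iff.2 h)

lemma measurable_mulE {p q : ℕ} {A : Ω → Matrix (Fin p) (Fin q) ℝ}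
    {v : Ω → EuclideanSpace ℝ (Fin q)} (hA : ∀ i j, Measurable fun ω => A ω i j)
    (hv : Measurable v) : Measurable fun ω => mulE (A ω) (v ω) :=
  measurable_euclidean_iff.2 fun i => by
    simp only [mulE, Matrix.mulVec, dotProduct]
    exact Finset.measurable_sum _ fun j _ => (hA i j).mul (measurable_euclidean_iff.1 hv j)

lemma measurable_mul_apply {p q s : ℕ} {A : Ω → Matrix (Fin p) (Fin q) ℝ}
    {B : Ω → Matrix (Fin q) (Fin s) ℝ} (hA : ∀ i j, Measurable fun ω => A ω i j)
    (hB : ∀ i j, Measurable fun ω => B ω i j) (i : Fin p) (j : Fin s) :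
    Measurable fun ω => (A ω * B ω) i j := by
  simp only [Matrix.mul_apply]
  exact Finset.measurable_sum _ fun l _ => (hA i l).mul (hB l j)

lemma measurable_det {p : ℕ} {A : Ω → Matrix (Fin p) (Fin p) ℝ}
    (hA : ∀ i j, Measurable fun ω => A ω i j) : Measurable fun ω => (A ω).det := by
  simp only [Matrix.det_apply']
  exact Finset.measurable_sum _ fun σ _ =>
    (Finset.measurable_prod _ fun i _ => hA (σ i) i).const_mul _

/-- By the adjugate formula; singular matrices need no exception, as $0^{-1}=0$ and inversion on
$\mathbb R$ is measurable. -/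
lemma measurable_inv_apply {p : ℕ} {A : Ω → Matrix (Fin p) (Fin p) ℝ}
    (hA : ∀ i j, Measurable fun ω => A ω i j) (i j : Fin p) :
    Measurable fun ω => (A ω)⁻¹ i j := by
  simp only [Matrix.inv_def, Matrix.smul_apply, smul_eq_mul, Ring.inverse_eq_inv',
    Matrix.adjugate_apply]
  refine (measurable_det hA).inv.mul (measurable_det fun k l => ?_)
  simp only [Matrix.updateRow_apply]
  split_ifs
  · exact measurable_const
  · exact hA k l

lemma measurable_jacobianModel_apply (hr : Measurable r) {γ : Ω → ℝ} {U : Ω → stiefel n b}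
    {x : Ω → EuclideanSpace ℝ (Fin n)} (hγ : Measurable γ) (hU : Measurable U)
    (hx : Measurable x) (i : Fin m) (l : Fin n) :
    Measurable fun ω => jacobianModel r (γ ω) (U ω) (x ω) i l := by
  have hc : ∀ j, Measurable fun ω => column (U ω) j := fun j =>
    (continuous_column j).measurable.comp hU
  have hri : ∀ {y : Ω → EuclideanSpace ℝ (Fin n)}, Measurable y →
      Measurable fun ω => r (y ω) i := fun hy => measurable_euclidean_iff.1 (hr.comp hy) i
  suffices h : Measurable fun ω => smoothedGradient r (γ ω) (U ω) (x ω) i from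
    measurable_euclidean_iff.1 h l
  unfold smoothedGradient
  have hsum := Finset.measurable_sum Finset.univ fun j (_ : j ∈ Finset.univ) =>
    (((hri (hx.add (hγ.smul (hc j)))).sub (hri hx)).div hγ).smul (hc j)
  exact hsum.const_smul ((n : ℝ) / b)

lemma measurable_gradientModel (hr : Measurable r) {γ : Ω → ℝ} {U : Ω → stiefel n b}
    {x : Ω → EuclideanSpace ℝ (Fin n)} (hγ : Measurable γ) (hU : Measurable U)
    (hx : Measurable x) : Measurable fun ω => gradientModel r (γ ω) (U ω) (x ω) :=
  measurable_mulE (fun i j => measurable_jacobianModel_apply hr hγ hU hx j i) (hr.comp hx)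

lemma measurable_lmStep {J : Ω → Matrix (Fin m) (Fin n) ℝ} {lam : Ω → ℝ}
    {v : Ω → EuclideanSpace ℝ (Fin m)} (hJ : ∀ i j, Measurable fun ω => J ω i j)
    (hlam : Measurable lam) (hv : Measurable v) :
    Measurable fun ω => lmStep (J ω) (lam ω) (v ω) := by
  have hJt : ∀ i j, Measurable fun ω => (J ω)ᵀ i j := fun i j => hJ j i
  refine (measurable_mulE (measurable_inv_apply fun i j => ?_) (measurable_mulE hJt hv)).neg
  exact (measurable_mul_apply hJt hJ i j).add (hlam.mul measurable_const)

lemma measurable_reductionRatio (hr : Measurable r) {J : Ω → Matrix (Fin m) (Fin n) ℝ}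
    {x d : Ω → EuclideanSpace ℝ (Fin n)} (hJ : ∀ i j, Measurable fun ω => J ω i j)
    (hx : Measurable x) (hd : Measurable d) :
    Measurable fun ω => reductionRatio r (J ω) (x ω) (d ω) :=
  (((hr.comp hx).norm.pow_const 2).sub ((hr.comp (hx.add hd)).norm.pow_const 2)).div
    (((hr.comp hx).norm.pow_const 2).sub
      (((hr.comp hx).add (measurable_mulE hJ hd)).norm.pow_const 2))

lemma measurable_updateTheta (par : Params) {θ ρ g : Ω → ℝ} (hθ : Measurable θ)
    (hρ : Measurable ρ) (hg : Measurable g) :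
    Measurable fun ω => updateTheta par (θ ω) (ρ ω) (g ω) := by
  unfold updateTheta
  exact Measurable.ite (measurableSet_lt hρ measurable_const) (hθ.const_mul _)
    (Measurable.ite (measurableSet_lt hg (measurable_const.div hθ)) (hθ.const_mul _)
      (Measurable.ite (measurableSet_lt hg (measurable_const.div hθ)) hθ
        ((hθ.const_mul _).max measurable_const)))

/-- A random state all of whose components are measurable. -/
structure MeasurableState (s : Ω → State n) : Prop where
  x : Measurable fun ω => (s ω).x
  θ : Measurable fun ω => (s ω).θ
  dPrev : Measurable fun ω => (s ω).dPrev
  stopped : Measurable fun ω => (s ω).stopped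

lemma MeasurableState.ite {p : Ω → Prop} [DecidablePred p] (hp : MeasurableSet {ω | p ω})
    {s t : Ω → State n} (hs : MeasurableState s) (ht : MeasurableState t) :
    MeasurableState fun ω => if p ω then s ω else t ω := by
  constructor <;> simp only [apply_ite State.x, apply_ite State.θ, apply_ite State.dPrev,
    apply_ite State.stopped]
  · exact Measurable.ite hp hs.x ht.x
  · exact Measurable.ite hp hs.θ ht.θ
  · exact Measurable.ite hp hs.dPrev ht.dPrev
  · exact Measurable.ite hp hs.stopped ht.stopped

lemma MeasurableState.step (par : Params) (hr : Measurable r) {s : Ω → State n}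
    (hs : MeasurableState s) {U : Ω → stiefel n b} (hU : Measurable U) :
    MeasurableState fun ω => step par r (U ω) (s ω) := by
  have hg := measurable_gradientModel hr hs.dPrev.norm hU hs.x
  have hJ := measurable_jacobianModel_apply hr hs.dPrev.norm hU hs.x
  have hd := measurable_lmStep hJ (hs.θ.mul hg.norm) (hr.comp hs.x)
  have hρ := measurable_reductionRatio hr hJ hs.x hd
  refine MeasurableState.ite ?_ ⟨hs.x, hs.θ, hs.dPrev, measurable_const⟩
    ⟨?_, measurable_updateTheta par hs.θ hρ hg.norm, hd, measurable_const⟩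
  · exact (hs.stopped (measurableSet_singleton true)).union
      (measurableSet_le hg.norm measurable_const)
  · exact Measurable.ite (measurableSet_le measurable_const hρ) (hs.x.add hd) hs.x

/-- Only the frames before $k$ are required to be measurable, so that `pastSigma U k` can serve as
the σ-algebra on `Ω`. -/
lemma measurableState_run (par : Params) (hr : Measurable r)
    (x₀ dInit : EuclideanSpace ℝ (Fin n)) {U : ℕ → Ω → stiefel n b} (k : ℕ)
    (hU : ∀ j < k, Measurable (U j)) :
    MeasurableState fun ω => run par r x₀ dInit (fun j => U j ω) k := by
  induction k with
  | zero => exact ⟨measurable_const, measurable_const, measurable_const, measurable_const⟩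
  | succ k ih => exact (ih fun j hj => hU j (by omega)).step par hr (hU k (by omega))

end Measurability

/-! ### Freezing the past in a conditional probability -/

section Conditioning

/-- Conditionally on a σ-algebra `m₀`, an `m₀`-measurable variable may be frozen in an event that
otherwise depends on a variable independent of `m₀`. -/
lemma ae_le_condProb_of_indep {Ω E F : Type*} {m₀ mΩ : MeasurableSpace Ω} [MeasurableSpace E]
    [MeasurableSpace F] {P : Measure Ω} [IsProbabilityMeasure P] (hm : m₀ ≤ mΩ) {X : Ω → E}
    (hX : Measurable[m₀] X) {V : Ω → F} (hV : Measurable V)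
    (hind : Indep m₀ (MeasurableSpace.comap V inferInstance) P) {B : Set (E × F)}
    (hB : MeasurableSet B) {α : ℝ} (h : ∀ ω, α ≤ (P.map V).real {v | (X ω, v) ∈ B}) :
    ∀ᵐ ω ∂P, α ≤ (P⟦{ω' | (X ω', V ω') ∈ B} | m₀⟧) ω := by
  have hX' : Measurable X := hX.mono hm le_rfl
  have : IsProbabilityMeasure (P.map V) := Measure.isProbabilityMeasure_map hV.aemeasurable
  set S : Set Ω := {ω' | (X ω', V ω') ∈ B} with hS
  have hSm : MeasurableSet S := (hX'.prodMk hV) hB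
  have hint : Integrable (S.indicator fun _ => (1 : ℝ)) P := (integrable_const _).indicator hSm
  -- This is the claim integrated over $A$; knowing it for every $A\in m_0$ is enough.
  have key : ∀ A, MeasurableSet[m₀] A → α * P.real A ≤ P.real (A ∩ S) := by
    intro A hA
    have hA' : MeasurableSet A := hm _ hA
    -- Membership in $A$ is adjoined to $X$, so that $A\cap S$ is an event of a pair with product
    -- law and Fubini applies.
    have hY : Measurable[m₀] fun ω => (X ω, ω ∈ A) :=
      hX.prodMk ((@measurable_mem _ A m₀).2 hA)
    have hY' : Measurable fun ω => (X ω, ω ∈ A) := hY.mono hm le_rfl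
    have hYV : IndepFun (fun ω => (X ω, ω ∈ A)) V P := by
      rw [IndepFun_iff_Indep]
      exact indep_of_indep_of_le_left hind hY.comap_le
    have hlaw := (indepFun_iff_map_prod_eq_prod_map_map hY'.aemeasurable hV.aemeasurable).1 hYV
    set C : Set ((E × Prop) × F) := {z | z.1.2 ∧ (z.1.1, z.2) ∈ B} with hC
    have hCm : MeasurableSet C :=
      (measurableSet_setOfPred.2 (measurable_snd.comp measurable_fst)).inter
        (((measurable_fst.comp measurable_fst).prodMk measurable_snd) hB)
    have h1 : P (A ∩ S) = ∫⁻ ω, (P.map V) {v | ω ∈ A ∧ (X ω, v) ∈ B} ∂P := by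
      have h2 : P (A ∩ S) = (P.map fun ω => ((X ω, ω ∈ A), V ω)) C := by
        rw [Measure.map_apply (hY'.prodMk hV) hCm]
        rfl
      rw [h2, hlaw, Measure.prod_apply hCm, lintegral_map (measurable_measure_prodMk_left hCm) hY']
      rfl
    have h3 : ∫⁻ ω, A.indicator (fun _ => ENNReal.ofReal α) ω ∂P ≤ P (A ∩ S) := by
      rw [h1]
      refine lintegral_mono fun ω => ?_
      by_cases hω : ω ∈ A
      · simp only [hω, Set.indicator_of_mem, true_and]
        exact (ENNReal.ofReal_le_iff_le_toReal (measure_ne_top _ _)).2 (h ω)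
      · simp [hω]
    rw [lintegral_indicator hA', lintegral_const, Measure.restrict_apply_univ] at h3
    have h4 := ENNReal.toReal_mono (measure_ne_top _ _) h3
    rw [ENNReal.toReal_mul] at h4
    refine le_trans ?_ h4
    exact mul_le_mul_of_nonneg_right (by
      rw [ENNReal.toReal_ofReal']
      exact le_max_left _ _) measureReal_nonneg
  -- For the measure restricted to $m_0$, integrals over $m_0$-sets decide the almost sure
  -- inequality.
  refine ae_le_of_ae_le_trim (hm := hm) (f₁ := fun _ => α) ?_
  refine ae_le_of_forall_setIntegral_le (integrable_const _)
    (integrable_condExp.trim hm stronglyMeasurable_condExp) fun A hA _ => ?_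
  rw [← setIntegral_trim hm stronglyMeasurable_const hA,
    ← setIntegral_trim hm stronglyMeasurable_condExp hA, setIntegral_condExp hm hint hA,
    setIntegral_const, integral_indicator_const _ hSm]
  simp only [measureReal_restrict_apply hSm, smul_eq_mul, mul_one]
  rw [mul_comm, Set.inter_comm]
  exact key A hA

end Conditioning

/-! ### Accuracy at a fixed iterate -/

section Accuracy

variable {n m b : ℕ} {r : EuclideanSpace ℝ (Fin n) → EuclideanSpace ℝ (Fin m)}

lemma continuous_gradient_objective (hr : ContDiff ℝ 1 r) :
    Continuous (gradient (objective r)) := by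
  have h : ContDiff ℝ 1 (objective r) := contDiff_const.mul (hr.norm_sq ℝ)
  exact (LinearIsometryEquiv.continuous _).comp (h.continuous_fderiv one_ne_zero)

/-- Accuracy of the gradient model at a fixed iterate. -/
lemma le_prob_norm_gradientModel_sub_le (hr : ContDiff ℝ 1 r) {κ : Fin m → ℝ}
    (hκpos : ∀ i, 0 < κ i)
    (hκ : ∀ i x y,
      ‖gradient (fun z => r z i) x - gradient (fun z => r z i) y‖ ≤ κ i * ‖x - y‖)
    (hb : 1 ≤ b) (hbn : b ≤ n) {x : EuclideanSpace ℝ (Fin n)} {γ R α : ℝ} (hγ : 0 < γ)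
    (hR : ‖r x‖ ≤ R) (hα₀ : 0 < α) (hα₁ : α < 1) :
    α ≤ (stiefelUniform hbn).real {U | ‖gradientModel r γ U x - gradient (objective r) x‖ ≤
      Real.sqrt (((n : ℝ) / b - 1) / (1 - α)) * ‖gradient (objective r) x‖ +
        Real.sqrt m * (⨆ i, κ i) * ((n : ℝ) / (2 * Real.sqrt (1 - α)) + 1) * R * γ} := by
  refine (le_prob_norm_scaledProjection_sub_le hb hbn (gradient (objective r) x) hα₁).trans
    (measureReal_mono fun U hU => ?_)
  have hsup : 0 ≤ ⨆ i, κ i := Real.iSup_nonneg fun i => (hκpos i).le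
  have h1 := norm_gradientModel_sub_scaledProjection_le
    (hr.differentiable one_ne_zero) hκpos hκ hb hγ U x
  have hs0 : 0 < Real.sqrt (1 - α) := Real.sqrt_pos.2 (by linarith)
  have hs1 : Real.sqrt (1 - α) ≤ 1 := Real.sqrt_le_one.2 (by linarith)
  -- The finite-difference error holds for every frame with constant $n/2$, which is below the one
  -- in $\xi_2$.
  have h2 : (n : ℝ) / 2 ≤ n / (2 * Real.sqrt (1 - α)) + 1 := by
    have : (n : ℝ) / 2 ≤ n / (2 * Real.sqrt (1 - α)) := by
      gcongr
      linarith
    linarith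
  have h3 : Real.sqrt m * (⨆ i, κ i) * (n / 2) * ‖r x‖ * γ ≤
      Real.sqrt m * (⨆ i, κ i) * ((n : ℝ) / (2 * Real.sqrt (1 - α)) + 1) * R * γ := by
    gcongr
  have h4 := norm_sub_le_norm_sub_add_norm_sub (gradientModel r γ U x)
    (scaledProjection U (gradient (objective r) x)) (gradient (objective r) x)
  rw [Set.mem_ofPred_eq] at hU ⊢
  linarith

end Accuracy

/-! ### The past σ-algebra and the main theorem -/

lemma pastSigma_le {Ω : Type*} {n b : ℕ} [mΩ : MeasurableSpace Ω] {U : ℕ → Ω → stiefel n b}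
    (hU : ∀ k, Measurable (U k)) (k : ℕ) : pastSigma U k ≤ mΩ :=
  iSup_le fun j => (hU j).comap_le

lemma measurable_pastSigma {Ω : Type*} {n b : ℕ} (U : ℕ → Ω → stiefel n b) {j k : ℕ}
    (h : j < k) : Measurable[pastSigma U k] (U j) :=
  Measurable.of_comap_le (le_iSup (fun j : Fin k => MeasurableSpace.comap (U j) inferInstance)
    ⟨j, h⟩)

lemma indep_pastSigma {Ω : Type*} {n b : ℕ} [MeasurableSpace Ω] {P : Measure Ω}
    {U : ℕ → Ω → stiefel n b} (hU : ∀ k, Measurable (U k)) (hind : iIndepFun U P) (k : ℕ) :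
    Indep (pastSigma U k) (MeasurableSpace.comap (U k) inferInstance) P := by
  have h := indep_iSup_of_disjoint (fun j => (hU j).comap_le) ((iIndepFun_iff_iIndep _ _ _).1 hind)
    (S := {j | j < k}) (T := {k}) (by simp)
  refine indep_of_indep_of_le_left (indep_of_indep_of_le_right h ?_) ?_
  · simp
  · exact iSup_le fun j => le_iSup₂_of_le (j : ℕ) j.2 le_rfl

end OrthLM

end

theorem theorem3p2 {Ω : Type*} [MeasurableSpace Ω] (P : Measure Ω) [IsProbabilityMeasure P]
    {n m b : ℕ}
    (r : EuclideanSpace ℝ (Fin n) → EuclideanSpace ℝ (Fin m)) (hr : ContDiff ℝ 1 r)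
    -- the Jacobian is Lipschitz, and `κ i` is a Lipschitz constant of `∇ rᵢ`
    (hJ : ∃ κlj : ℝ, 0 < κlj ∧ ∀ x y, ‖fderiv ℝ r x - fderiv ℝ r y‖ ≤ κlj * ‖x - y‖)
    (κ : Fin m → ℝ) (hκpos : ∀ i, 0 < κ i)
    (hκ : ∀ i x y,
      ‖gradient (fun z => r z i) x - gradient (fun z => r z i) y‖ ≤ κ i * ‖x - y‖)
    -- the sample size
    (hb : 1 ≤ b) (hbn : b ≤ n) (hbn2 : (n : ℝ) / 2 ≤ b)
    -- the inputs of the algorithm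
    (par : OrthLM.Params) (x₀ dInit : EuclideanSpace ℝ (Fin n))
    (hr₀ : ‖r x₀‖ ≠ 0) (hdInit : dInit ≠ 0)
    -- independent uniformly distributed orthonormal frames, one for each iteration
    (U : ℕ → Ω → OrthLM.stiefel n b) (hUmeas : ∀ k, Measurable (U k))
    (hUlaw : ∀ k, P.map (U k) = OrthLM.stiefelUniform hbn) (hUindep : iIndepFun U P)
    (α : ℝ) (hα₀ : 0 < α) (hα₁ : α < 1) :
    OrthLM.ProbFirstOrderAccurate P (OrthLM.objective r) (OrthLM.pastSigma U)
      (fun k ω => (OrthLM.run par r x₀ dInit (fun j => U j ω) k).x)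
      (fun k ω => (OrthLM.run par r x₀ dInit (fun j => U j ω) k).dPrev)
      (fun k ω =>
        OrthLM.gradientModel r ‖(OrthLM.run par r x₀ dInit (fun j => U j ω) k).dPrev‖ (U k ω)
          (OrthLM.run par r x₀ dInit (fun j => U j ω) k).x)
      α
      (Real.sqrt (((n : ℝ) / b - 1) / (1 - α)))
      (Real.sqrt m * (⨆ i, κ i) * ((n : ℝ) / (2 * Real.sqrt (1 - α)) + 1) * ‖r x₀‖) := by
  intro k
  have hr' : Measurable r := hr.continuous.measurable
  have hs : @OrthLM.MeasurableState Ω (OrthLM.pastSigma U k) n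
      fun ω => OrthLM.run par r x₀ dInit (fun j => U j ω) k :=
    @OrthLM.measurableState_run Ω (OrthLM.pastSigma U k) n m b r par hr' x₀ dInit U k
      fun j hj => OrthLM.measurable_pastSigma U hj
  have hgrad := (OrthLM.continuous_gradient_objective hr).measurable
  refine OrthLM.ae_le_condProb_of_indep (OrthLM.pastSigma_le hUmeas k)
    (X := fun ω => ((OrthLM.run par r x₀ dInit (fun j => U j ω) k).x,
      (OrthLM.run par r x₀ dInit (fun j => U j ω) k).dPrev))
    ((@OrthLM.MeasurableState.x _ (OrthLM.pastSigma U k) _ _ hs).prodMk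
      (@OrthLM.MeasurableState.dPrev _ (OrthLM.pastSigma U k) _ _ hs)) (hUmeas k)
    (OrthLM.indep_pastSigma hUmeas hUindep k)
    (B := {z | ‖OrthLM.gradientModel r ‖z.1.2‖ z.2 z.1.1 -
      gradient (OrthLM.objective r) z.1.1‖ ≤
      Real.sqrt (((n : ℝ) / b - 1) / (1 - α)) * ‖gradient (OrthLM.objective r) z.1.1‖ +
      Real.sqrt m * (⨆ i, κ i) * ((n : ℝ) / (2 * Real.sqrt (1 - α)) + 1) * ‖r x₀‖ * ‖z.1.2‖})
    ?_ fun ω => ?_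
  · have h1 : Measurable fun z : (EuclideanSpace ℝ (Fin n) × EuclideanSpace ℝ (Fin n)) ×
        OrthLM.stiefel n b => z.1.1 := measurable_fst.comp measurable_fst
    have h2 : Measurable fun z : (EuclideanSpace ℝ (Fin n) × EuclideanSpace ℝ (Fin n)) ×
        OrthLM.stiefel n b => z.1.2 := measurable_snd.comp measurable_fst
    exact measurableSet_le
      ((OrthLM.measurable_gradientModel hr' h2.norm measurable_snd h1).sub
        (hgrad.comp h1)).norm
      (((hgrad.comp h1).norm.const_mul _).add (h2.norm.const_mul _))
  · have hv := OrthLM.run_valid (r := r) par (x₀ := x₀) hdInit (fun j => U j ω) k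
    rw [hUlaw k]
    -- Once the past is frozen, only the validity of the state matters.
    generalize OrthLM.run par r x₀ dInit (fun j => U j ω) k = s at hv ⊢
    have h := OrthLM.le_prob_norm_gradientModel_sub_le hr hκpos hκ hb hbn
      (norm_pos_iff.2 hv.dPrev_ne_zero) hv.norm_le hα₀ hα₁
    simpa only [Set.mem_ofPred_eq] using h
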